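/- **Proposition 1.6.** Let $R$ be a ring (associative, with $1$) and let $\mathrm{Mod}\,R$ be the category of right $R$-modules. Let $\mathcal U$ be a set of finitely presented right $R$-modules of projective dimension at most one, and let $$\mathcal X_{\mathcal U}=\{M\in \mathrm{Mod}\,R \mid \mathrm{Hom}_R(U,M)=0 \text{ and } \mathrm{Ext}^i_R(U,M)=0 \text{ for all } U\in\mathcal U \text{ and all } i>0\}$$ be its perpendicular category, viewed as a full subcategory of $\mathrm{Mod}\,R$. Then: 1. $\mathcal X_{\mathcal U}$ is bireflective, that is, it is closed under isomorphic images and direct summands, and the inclusion $\mathcal X_{\mathcal U}\hookrightarrow \mathrm{Mod}\,R$ has a left adjoint and a right adjoint. 2. Every $U\in\mathcal U$ admits a short exact sequence $0\to P_U\xrightarrow{\alpha_U} Q_U\to U\to 0$ with $P_U,Q_U$ finitely generated projective. For every choice of such sequences, put $\Sigma=\{\alpha_U\mid U\in\mathcal U\}$. A ring homomorphism $f:R\to S$ is called $\Sigma$-inverting if $\alpha\otimes_R 1_S$ is an isomorphism of right $S$-modules for all $\alpha\in\Sigma$. There is a universal localization $\lambda:R\to R_{\mathcal U}$ of $R$ at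 $\Sigma$, that is, a $\Sigma$-inverting ring homomorphism through which every $\Sigma$-inverting ring homomorphism $R\to T$ factors uniquely. For every such $\lambda$, the category $\mathcal X_{\mathcal U}$ coincides with the essential image of the restriction functor $\mathrm{Mod}\,R_{\mathcal U}\to\mathrm{Mod}\,R$ along $\lambda$. -/

import Mathlib

open CategoryTheory MulOpposite
open scoped TensorProduct

universe u

/-!
Right modules over a ring `R` are modules over `Rᵐᵒᵖ`, and `Mod R` is `ModuleCat.{u} Rᵐᵒᵖ`.
-/

namespace UnivLoc

/-- The perpendicular category of a class `𝒰` of right `R`-modules, as a full subcategory of `Mod R`: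
all `M` with `Hom_R(U, M) = 0` and `Ext^i_R(U, M) = 0` for every `U` in `𝒰` and every `i > 0`. -/
def perp {R : Type u} [Ring R] (𝒰 : Set (ModuleCat.{u} Rᵐᵒᵖ)) :
    ObjectProperty (ModuleCat.{u} Rᵐᵒᵖ) := fun M =>
  (∀ U ∈ 𝒰, ∀ g : U ⟶ M, g = 0) ∧
    ∀ U ∈ 𝒰, ∀ i : ℕ, 0 < i → ∀ e : Abelian.Ext U M i, e = 0

/-- A bireflective subcategory: a full subcategory, closed under isomorphic images and direct
summands, which is reflective and coreflective. -/
structure IsBireflective {C : Type*} [Category C] (𝒳 : ObjectProperty C) : Prop where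
  closedUnderIso : 𝒳.IsClosedUnderIsomorphisms
  closedUnderSummands : 𝒳.IsStableUnderRetracts
  reflective : Nonempty (Reflective 𝒳.ι)
  coreflective : Nonempty (Coreflective 𝒳.ι)

/-- The relations `(p r) ⊗ s = p ⊗ (f r) s` that cut `P ⊗_R S` out of `P ⊗_ℤ S`. The two factors
are written in the reverse order, so that the right action of `S` is on the first one. -/
def tensorRel {R S : Type u} [Ring R] [Ring S] (f : R →+* S)
    (P : Type u) [AddCommGroup P] [Module Rᵐᵒᵖ P] : Submodule Sᵐᵒᵖ (S ⊗[ℤ] P) :=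
  Submodule.span Sᵐᵒᵖ
    {x | ∃ (r : R) (s : S) (p : P), x = (f r * s) ⊗ₜ[ℤ] p - s ⊗ₜ[ℤ] (op r • p)}

/-- The right `S`-module `P ⊗_R S`, for a right `R`-module `P` and a ring homomorphism
`f : R → S`. -/
abbrev Tensor {R S : Type u} [Ring R] [Ring S] (f : R →+* S)
    (P : Type u) [AddCommGroup P] [Module Rᵐᵒᵖ P] : Type u :=
  (S ⊗[ℤ] P) ⧸ tensorRel f P

/-- The homomorphism `α ⊗_R 1_S : P ⊗_R S → Q ⊗_R S` of right `S`-modules. -/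
def tensorMap {R S : Type u} [Ring R] [Ring S] (f : R →+* S)
    {P Q : Type u} [AddCommGroup P] [Module Rᵐᵒᵖ P] [AddCommGroup Q] [Module Rᵐᵒᵖ Q]
    (α : P →ₗ[Rᵐᵒᵖ] Q) : Tensor f P →ₗ[Sᵐᵒᵖ] Tensor f Q :=
  Submodule.mapQ (tensorRel f P) (tensorRel f Q)
    (TensorProduct.AlgebraTensorModule.map (LinearMap.id : S →ₗ[Sᵐᵒᵖ] S)
      α.toAddMonoidHom.toIntLinearMap) (by
    rw [tensorRel, Submodule.span_le]
    rintro _ ⟨r, s, p, rfl⟩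
    refine Submodule.subset_span ⟨r, s, α p, ?_⟩
    simp)

/-- `f : R → S` is `A`-inverting: `α ⊗_R 1_S` is an isomorphism for every `α` in `A`. -/
def IsInverting {R S : Type u} [Ring R] [Ring S] (A : Set (Arrow (ModuleCat.{u} Rᵐᵒᵖ)))
    (f : R →+* S) : Prop :=
  ∀ α ∈ A, Function.Bijective (tensorMap f α.hom.hom)

/-- `f : R → S` is a universal localization of `R` at the set `A` of morphisms: it is
`A`-inverting, and every `A`-inverting ring homomorphism factors uniquely through it. -/
structure IsUniversalLocalization {R S : Type u} [Ring R] [Ring S]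
    (A : Set (Arrow (ModuleCat.{u} Rᵐᵒᵖ))) (f : R →+* S) : Prop where
  inverting : IsInverting A f
  existsUnique_lift : ∀ (T : Type u) [Ring T] (g : R →+* T), IsInverting A g →
    ∃! h : S →+* T, h.comp f = g

/-- A short exact sequence `0 → P → Q → U → 0` of right `R`-modules with `P` and `Q` finitely
generated projective. -/
structure ProjRes {R : Type u} [Ring R] (U : ModuleCat.{u} Rᵐᵒᵖ) where
  P : ModuleCat.{u} Rᵐᵒᵖ
  Q : ModuleCat.{u} Rᵐᵒᵖ
  α : P ⟶ Q
  π : Q ⟶ U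
  finite_P : Module.Finite Rᵐᵒᵖ P
  projective_P : Module.Projective Rᵐᵒᵖ P
  finite_Q : Module.Finite Rᵐᵒᵖ Q
  projective_Q : Module.Projective Rᵐᵒᵖ Q
  injective : Function.Injective α
  exact : Function.Exact α π
  surjective : Function.Surjective π

/-- The set `{α_U | U ∈ 𝒰}` given by a choice of sequences `0 → P → Q → U → 0` with maps
`α_U : P → Q`. -/
def chosenMaps {R : Type u} [Ring R] {𝒰 : Set (ModuleCat.{u} Rᵐᵒᵖ)}
    (res : ∀ U : 𝒰, ProjRes U.1) : Set (Arrow (ModuleCat.{u} Rᵐᵒᵖ)) :=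
  Set.range fun U : 𝒰 => Arrow.mk (res U).α

end UnivLoc

/-! Apply `Hom(-, M)` to `0 → P → Q → U → 0`. Since `P` and `Q` are projective, the long exact
sequence shows that `M` is perpendicular to `U` iff every map `P → M` extends uniquely along `α : P
→ Q` (`ProjRes.ext_eq_zero_iff`). By tensor-hom adjunction this holds for all restricted `S`-modules
as soon as `α ⊗ 1_S` is invertible. As `P` and `Q` are finitely generated projective, the single
test module `S` already forces invertibility (`bijective_tensorMap_iff`).

Conversely, if `M` is perpendicular, extending pointwise in `m ∈ M` shows that the action `R →
End_ℤ(M)ᵒᵖ` is inverting (`isInverting_rightAction`). It therefore factors through the localization,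
which makes `M` a module over it (`perp_eq_essImage`).

The localization is built by adjoining the coefficients of the inverses (`Loc`). It is a ring
epimorphism, so restriction is full (`full_restrictScalars`). Restriction also has adjoints on both
sides, and these pass to its essential image (`isBireflective_perp`). -/

namespace UnivLoc

/-! ### Inverting `α ⊗_R 1_S`: tensor-hom adjunction and matrix coefficients -/

section Semilinear

variable {R S : Type u} [Ring R] [Ring S] (f : R →+* S)
  {P Q : Type u} [AddCommGroup P] [Module Rᵐᵒᵖ P] [AddCommGroup Q] [Module Rᵐᵒᵖ Q]
  {N : Type u} [AddCommGroup N] [Module Sᵐᵒᵖ N]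

lemma exists_dual_basis (P : Type u) [AddCommGroup P] [Module Rᵐᵒᵖ P] [Module.Finite Rᵐᵒᵖ P]
    [Module.Projective Rᵐᵒᵖ P] :
    ∃ (n : ℕ) (e : Fin n → P) (φ : Fin n → (P →ₗ[Rᵐᵒᵖ] R)),
      ∀ x, ∑ i, op (φ i x) • e i = x := by
  obtain ⟨n, g, h, -, -, hgh⟩ := Module.Finite.exists_comp_eq_id_of_projective Rᵐᵒᵖ P
  refine ⟨n, fun i => g (Pi.single i 1), fun i =>
    { toFun := fun x => unop (h x i)
      map_add' := by simp
      map_smul' := by simp }, fun x => ?_⟩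
  have hx : g (h x) = x := LinearMap.congr_fun hgh x
  conv_rhs => rw [← hx, ← Finset.univ_sum_single (h x)]
  simp only [map_sum, LinearMap.coe_mk, AddHom.coe_mk, op_unop]
  refine Finset.sum_congr rfl fun i _ => ?_
  rw [← map_smul, ← Pi.single_smul', smul_eq_mul, mul_one]

/-- The class of `s ⊗ p` in `P ⊗_R S`. -/
def tmul (s : S) (p : P) : Tensor f P := (tensorRel f P).mkQ (s ⊗ₜ[ℤ] p)

lemma tmul_add (s : S) (p p' : P) : tmul f s (p + p') = tmul f s p + tmul f s p' := by
  simp [tmul, TensorProduct.tmul_add]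

lemma add_tmul (s s' : S) (p : P) : tmul f (s + s') p = tmul f s p + tmul f s' p := by
  simp [tmul, TensorProduct.add_tmul]

/-- `s ⊗ p` as an additive map in `s`. -/
def tmulLeft (p : P) : S →+ Tensor f P := AddMonoidHom.mk' (tmul f · p) fun _ _ => add_tmul f _ _ _

/-- `s ⊗ p` as an additive map in `p`. -/
def tmulRight (s : S) : P →+ Tensor f P := AddMonoidHom.mk' (tmul f s) fun _ _ => tmul_add f _ _ _

lemma sum_tmul {ι : Type*} (t : Finset ι) (s : ι → S) (p : P) :
    tmul f (∑ i ∈ t, s i) p = ∑ i ∈ t, tmul f (s i) p := map_sum (tmulLeft f p) s t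

lemma tmul_sum {ι : Type*} (t : Finset ι) (s : S) (p : ι → P) :
    tmul f s (∑ i ∈ t, p i) = ∑ i ∈ t, tmul f s (p i) := map_sum (tmulRight f s) p t

lemma tmul_smul (r : R) (s : S) (p : P) : tmul f s (op r • p) = tmul f (f r * s) p := by
  rw [eq_comm, ← sub_eq_zero, tmul, tmul, ← map_sub, Submodule.mkQ_apply,
    Submodule.Quotient.mk_eq_zero]
  exact Submodule.subset_span ⟨r, s, p, rfl⟩

lemma smul_tmul (t : Sᵐᵒᵖ) (s : S) (p : P) : t • tmul f s p = tmul f (s * unop t) p := by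
  rw [tmul, ← map_smul, TensorProduct.smul_tmul']; rfl

@[simp]
lemma tensorMap_tmul (α : P →ₗ[Rᵐᵒᵖ] Q) (s : S) (p : P) :
    tensorMap f α (tmul f s p) = tmul f s (α p) := rfl

lemma addHom_ext_tmul {A : Type*} [AddCommGroup A] {g h : Tensor f P →+ A}
    (H : ∀ s p, g (tmul f s p) = h (tmul f s p)) : g = h := by
  ext x
  obtain ⟨x, rfl⟩ := Submodule.mkQ_surjective _ x
  induction x with
  | zero => simp
  | tmul s p => exact H s p
  | add x y hx hy => rw [map_add, map_add, map_add, hx, hy]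

lemma linearMap_ext_tmul {g h : Tensor f P →ₗ[Sᵐᵒᵖ] N}
    (H : ∀ p, g (tmul f 1 p) = h (tmul f 1 p)) : g = h := by
  have : g.toAddMonoidHom = h.toAddMonoidHom := addHom_ext_tmul f fun s p => by
    have hs : tmul f s p = op s • tmul f 1 p := by rw [smul_tmul]; simp
    simp [hs, H]
  exact LinearMap.ext fun x => DFunLike.congr_fun this x

/-- The homomorphism `P ⊗_R S → N` of right `S`-modules induced by a homomorphism `P → N`
which is semilinear along `R → S`. -/
def tensorLift (h : P →ₛₗ[RingHom.op f] N) : Tensor f P →ₗ[Sᵐᵒᵖ] N :=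
  Submodule.liftQ (tensorRel f P)
    (TensorProduct.AlgebraTensorModule.lift
      { toFun := fun s => (DistribSMul.toAddMonoidHom N (op s)).comp h.toAddMonoidHom
          |>.toIntLinearMap
        map_add' := fun s t => by ext; simp [add_smul]
        map_smul' := fun s t => by ext; simp [mul_smul] }) (by
    rw [tensorRel, Submodule.span_le]
    rintro _ ⟨r, s, p, rfl⟩
    simp [mul_smul])

@[simp]
lemma tensorLift_tmul (h : P →ₛₗ[RingHom.op f] N) (s : S) (p : P) :
    tensorLift f h (tmul f s p) = op s • h p := rfl

/-- The semilinear map `P → P ⊗_R S`. -/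
def toTensor : P →ₛₗ[RingHom.op f] Tensor f P where
  toFun := tmul f 1
  map_add' := tmul_add f 1
  map_smul' r p := by
    obtain ⟨r, rfl⟩ := op_surjective r
    rw [tmul_smul, smul_tmul]
    simp

@[simp]
lemma toTensor_apply (p : P) : toTensor f p = tmul f 1 p := rfl

/-- Semilinear maps `P → N` are `S`-linear maps `P ⊗_R S → N`, and precomposition with `α`
corresponds to precomposition with `α ⊗ 1`. -/
lemma bijective_comp_of_bijective_tensorMap (α : P →ₗ[Rᵐᵒᵖ] Q)
    (hα : Function.Bijective (tensorMap f α)) :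
    Function.Bijective fun h : Q →ₛₗ[RingHom.op f] N => h.comp α := by
  constructor
  · intro h h' H
    have : tensorLift f h = tensorLift f h' := by
      have H' : (tensorLift f h).comp (tensorMap f α) = (tensorLift f h').comp (tensorMap f α) :=
        linearMap_ext_tmul f fun p => by simpa using LinearMap.congr_fun H p
      refine LinearMap.ext fun y => ?_
      obtain ⟨x, rfl⟩ := hα.2 y
      exact LinearMap.congr_fun H' x
    ext q
    simpa using LinearMap.congr_fun this (tmul f 1 q)
  · intro h
    let e := LinearEquiv.ofBijective _ hα
    refine ⟨((tensorLift f h).comp e.symm.toLinearMap).comp (toTensor f), ?_⟩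
    ext p
    have : e.symm (tmul f 1 (α p)) = tmul f 1 p := by
      rw [LinearEquiv.symm_apply_eq]; rfl
    simp [this]

/-- An inverse of `α ⊗_R 1_S : P ⊗_R S → Q ⊗_R S`, for finitely generated projective `P` and `Q`,
described by its matrix coefficients `(φ ⊗ 1) ((α ⊗ 1)⁻¹ (q ⊗ 1))` for `φ : P → R` and `q ∈ Q`. -/
structure DualInverse (α : P →ₗ[Rᵐᵒᵖ] Q) where
  coeff : (P →ₗ[Rᵐᵒᵖ] R) → Q → S
  add_left : ∀ φ φ' q, coeff (φ + φ') q = coeff φ q + coeff φ' q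
  smul_left : ∀ r φ q, coeff (r • φ) q = f r * coeff φ q
  add_right : ∀ φ q q', coeff φ (q + q') = coeff φ q + coeff φ q'
  smul_right : ∀ r φ q, coeff φ (op r • q) = coeff φ q * f r
  apply_right : ∀ φ p, coeff φ (α p) = f (φ p)
  comp_left : ∀ (ψ : Q →ₗ[Rᵐᵒᵖ] R) q, coeff (ψ.comp α) q = f (ψ q)

namespace DualInverse

variable {f} {α : P →ₗ[Rᵐᵒᵖ] Q}

/-- The image of an inverse of `α ⊗_R 1_S` under a ring homomorphism `S → T`. -/
def map {T : Type u} [Ring T] (b : DualInverse f α) (h : S →+* T) :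
    DualInverse (h.comp f) α where
  coeff φ q := h (b.coeff φ q)
  add_left := by simp [b.add_left]
  smul_left := by simp [b.smul_left]
  add_right := by simp [b.add_right]
  smul_right := by simp [b.smul_right]
  apply_right := by simp [b.apply_right]
  comp_left := by simp [b.comp_left]

/-- The coefficients as a semilinear map. -/
def coeffHom (b : DualInverse f α) (φ : P →ₗ[Rᵐᵒᵖ] R) : Q →ₛₗ[RingHom.op f] S where
  toFun := b.coeff φ
  map_add' := b.add_right φ
  map_smul' r q := by
    obtain ⟨r, rfl⟩ := op_surjective r
    simp [b.smul_right]

/-- The coefficients as an additive map in the linear form. -/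
def coeffLeft (b : DualInverse f α) (q : Q) : (P →ₗ[Rᵐᵒᵖ] R) →+ S :=
  AddMonoidHom.mk' (b.coeff · q) fun _ _ => b.add_left _ _ _

lemma coeff_sum_smul (b : DualInverse f α) {ι : Type*} (t : Finset ι) (r : ι → R)
    (φ : ι → (P →ₗ[Rᵐᵒᵖ] R)) (q : Q) :
    b.coeff (∑ i ∈ t, r i • φ i) q = ∑ i ∈ t, f (r i) * b.coeff (φ i) q :=
  (map_sum (b.coeffLeft q) _ t).trans (Finset.sum_congr rfl fun _ _ => b.smul_left _ _ _)

/-- The inverse is rebuilt from its coefficients by `q ⊗ 1 ↦ ∑ e i ⊗ coeff (φ i) q`, for a dual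
basis `(e, φ)` of `P`. -/
lemma bijective_tensorMap [Module.Finite Rᵐᵒᵖ P] [Module.Projective Rᵐᵒᵖ P]
    [Module.Finite Rᵐᵒᵖ Q] [Module.Projective Rᵐᵒᵖ Q] (b : DualInverse f α) :
    Function.Bijective (tensorMap f α) := by
  obtain ⟨n, e, φ, hφ⟩ := exists_dual_basis (R := R) P
  obtain ⟨m, d, ψ, hψ⟩ := exists_dual_basis (R := R) Q
  let β : Tensor f Q →ₗ[Sᵐᵒᵖ] Tensor f P := tensorLift f
    { toFun := fun q => ∑ i, tmul f (b.coeff (φ i) q) (e i)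
      map_add' := fun q q' => by simp [b.add_right, add_tmul, Finset.sum_add_distrib]
      map_smul' := fun r q => by
        obtain ⟨r, rfl⟩ := op_surjective r
        simp [b.smul_right, Finset.smul_sum, smul_tmul] }
  have hβ (q : Q) : β (tmul f 1 q) = ∑ i, tmul f (b.coeff (φ i) q) (e i) := by simp [β]
  refine Function.bijective_iff_has_inverse.2 ⟨β, fun x => ?_, fun y => ?_⟩
  · refine LinearMap.congr_fun (f := β.comp (tensorMap f α)) (g := LinearMap.id)
      (linearMap_ext_tmul f fun p => ?_) x
    rw [LinearMap.comp_apply, tensorMap_tmul, hβ, LinearMap.id_apply]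
    conv_rhs => rw [← hφ p, tmul_sum]
    simp [b.apply_right, tmul_smul]
  · refine LinearMap.congr_fun (f := (tensorMap f α).comp β) (g := LinearMap.id)
      (linearMap_ext_tmul f fun q => ?_) y
    rw [LinearMap.comp_apply, hβ, LinearMap.id_apply, map_sum]
    -- Expanding `ψ j ∘ α` in the dual basis lets `comp_left` evaluate the sum over `i`.
    have hα (j : Fin m) : ∑ i, ψ j (α (e i)) • φ i = (ψ j).comp α := by
      ext p
      conv_rhs => rw [LinearMap.comp_apply, ← hφ p]
      simp
    calc ∑ i, tensorMap f α (tmul f (b.coeff (φ i) q) (e i))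
        = ∑ i, ∑ j, tmul f (f (ψ j (α (e i))) * b.coeff (φ i) q) (d j) := by
          refine Finset.sum_congr rfl fun i _ => ?_
          rw [tensorMap_tmul]
          conv_lhs => rw [← hψ (α (e i)), tmul_sum]
          simp [tmul_smul]
      _ = ∑ j, tmul f (f (ψ j q)) (d j) := by
          rw [Finset.sum_comm]
          refine Finset.sum_congr rfl fun j _ => ?_
          rw [← sum_tmul, ← b.coeff_sum_smul, hα, b.comp_left]
      _ = tmul f 1 q := by
          conv_rhs => rw [← hψ q, tmul_sum]
          simp [tmul_smul]

/-- The coefficient map of `φ` is the unique extension along `α` of `f ∘ φ : P → S`; the remaining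
identities hold after restriction to `P`, hence on `Q` by uniqueness. -/
lemma nonempty_of_bijective
    (hα : Function.Bijective fun h : Q →ₛₗ[RingHom.op f] S => h.comp α) :
    Nonempty (DualInverse f α) := by
  let post {A : Type u} [AddCommGroup A] [Module Rᵐᵒᵖ A] (φ : A →ₗ[Rᵐᵒᵖ] R) :
      A →ₛₗ[RingHom.op f] S :=
    { toFun := fun a => f (φ a)
      map_add' := by simp
      map_smul' := by simp }
  choose b hb using fun φ : P →ₗ[Rᵐᵒᵖ] R => hα.2 (post φ)
  have hb' (φ p) : b φ (α p) = f (φ p) := LinearMap.congr_fun (hb φ) p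
  have ext' (h h' : Q →ₛₗ[RingHom.op f] S) (H : ∀ p, h (α p) = h' (α p)) (q : Q) :
      h q = h' q := LinearMap.congr_fun (hα.1 (LinearMap.ext H)) q
  refine ⟨⟨fun φ q => b φ q, fun φ φ' q => ?_, fun r φ q => ?_, by simp, by simp, hb',
    fun ψ q => ?_⟩⟩
  · exact ext' (b (φ + φ')) (b φ + b φ') (by simp [hb']) q
  · exact ext' (b (r • φ)) (f r • b φ) (by simp [hb']) q
  · exact ext' (b (ψ.comp α)) (post ψ) (fun p => hb' _ p) q

lemma coeff_eq_of_bijective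
    (hα : Function.Bijective fun h : Q →ₛₗ[RingHom.op f] S => h.comp α)
    (b b' : DualInverse f α) (φ : P →ₗ[Rᵐᵒᵖ] R) (q : Q) : b.coeff φ q = b'.coeff φ q :=
  LinearMap.congr_fun (hα.1 (a₁ := b.coeffHom φ) (a₂ := b'.coeffHom φ)
    (LinearMap.ext fun p => (b.apply_right φ p).trans (b'.apply_right φ p).symm)) q

end DualInverse

lemma bijective_tensorMap_iff [Module.Finite Rᵐᵒᵖ P] [Module.Projective Rᵐᵒᵖ P]
    [Module.Finite Rᵐᵒᵖ Q] [Module.Projective Rᵐᵒᵖ Q] (α : P →ₗ[Rᵐᵒᵖ] Q) :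
    Function.Bijective (tensorMap f α) ↔
      Function.Bijective fun h : Q →ₛₗ[RingHom.op f] S => h.comp α :=
  ⟨bijective_comp_of_bijective_tensorMap f α, fun h =>
    (DualInverse.nonempty_of_bijective h).elim DualInverse.bijective_tensorMap⟩

/-- Coefficients can simply be pushed forward along `h`. -/
lemma bijective_tensorMap_comp [Module.Finite Rᵐᵒᵖ P] [Module.Projective Rᵐᵒᵖ P]
    [Module.Finite Rᵐᵒᵖ Q] [Module.Projective Rᵐᵒᵖ Q] {T : Type u} [Ring T] (h : S →+* T)
    {α : P →ₗ[Rᵐᵒᵖ] Q} (hα : Function.Bijective (tensorMap f α)) :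
    Function.Bijective (tensorMap (h.comp f) α) :=
  (DualInverse.nonempty_of_bijective ((bijective_tensorMap_iff f α).1 hα)).elim
    fun b => (b.map h).bijective_tensorMap

/-- The ring homomorphism to the opposite of the additive endomorphisms of a right module which
is given by the action. -/
@[simps]
def rightAction (R : Type u) [Ring R] (M : Type u) [AddCommGroup M] [Module Rᵐᵒᵖ M] :
    R →+* (AddMonoid.End M)ᵐᵒᵖ where
  toFun r := op (Module.toAddMonoidEnd Rᵐᵒᵖ M (op r))
  map_one' := by simp
  map_mul' r s := by simp
  map_zero' := by simp
  map_add' r s := by simp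

/-- A semilinear map from `Q` to `End_ℤ(M)ᵒᵖ` is a family of `R`-linear maps `Q → M`, additive in `m
∈ M`. Each member extends uniquely, and uniqueness makes the extensions additive in `m`. -/
lemma bijective_comp_rightAction (M : Type u) [AddCommGroup M] [Module Rᵐᵒᵖ M]
    (α : P →ₗ[Rᵐᵒᵖ] Q) (hα : Function.Bijective fun h : Q →ₗ[Rᵐᵒᵖ] M => h.comp α) :
    Function.Bijective fun h : Q →ₛₗ[RingHom.op (rightAction R M)] (AddMonoid.End M)ᵐᵒᵖ =>
      h.comp α := by
  let ev {A : Type u} [AddCommGroup A] [Module Rᵐᵒᵖ A]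
      (h : A →ₛₗ[RingHom.op (rightAction R M)] (AddMonoid.End M)ᵐᵒᵖ) (m : M) : A →ₗ[Rᵐᵒᵖ] M :=
    { toFun := fun a => (h a).unop m
      map_add' := fun a a' => by rw [map_add]; rfl
      map_smul' := fun r a => by rw [map_smulₛₗ]; rfl }
  have ext' (h h' : Q →ₗ[Rᵐᵒᵖ] M) (H : ∀ p, h (α p) = h' (α p)) (q : Q) :
      h q = h' q := LinearMap.congr_fun (hα.1 (LinearMap.ext H)) q
  constructor
  · intro h h' H
    ext q
    refine unop_injective (AddMonoidHom.ext fun m => ext' (ev h m) (ev h' m) (fun p => ?_) q)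
    exact congrArg (fun x : (AddMonoid.End M)ᵐᵒᵖ => x.unop m) (LinearMap.congr_fun H p)
  · intro h
    choose k hk using fun m => hα.2 (ev h m)
    have hk' (m p) : k m (α p) = (h p).unop m := LinearMap.congr_fun (hk m) p
    refine ⟨{ toFun := fun q => op (AddMonoidHom.mk' (fun m => k m q) fun m m' => ?_),
              map_add' := ?_, map_smul' := ?_ }, ?_⟩
    · exact ext' (k (m + m')) (k m + k m') (by simp [hk']) q
    · intro q q'
      exact unop_injective (AddMonoidHom.ext fun m => map_add (k m) q q')
    · intro r q
      exact unop_injective (AddMonoidHom.ext fun m => map_smul (k m) r q)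
    · ext p
      refine unop_injective (AddMonoidHom.ext fun m => ?_)
      exact hk' m p

end Semilinear

/-! ### The universal localization by generators and relations -/

section Construction

variable {R : Type u} [Ring R] {I : Type u} {P Q : I → Type u}
  [∀ i, AddCommGroup (P i)] [∀ i, Module Rᵐᵒᵖ (P i)]
  [∀ i, AddCommGroup (Q i)] [∀ i, Module Rᵐᵒᵖ (Q i)]
  (α : ∀ i, P i →ₗ[Rᵐᵒᵖ] Q i)

/-- The free ring on `R` and on the matrix coefficients of inverses of the `α i`. -/
abbrev LocFree (_ : ∀ i, P i →ₗ[Rᵐᵒᵖ] Q i) : Type u :=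
  FreeAlgebra ℤ (R ⊕ Σ i, (P i →ₗ[Rᵐᵒᵖ] R) × Q i)

/-- The generator of `LocFree α` given by an element of `R`. -/
def LocFree.of (r : R) : LocFree α := FreeAlgebra.ι ℤ (Sum.inl r)

/-- The generator of `LocFree α` given by a matrix coefficient. -/
def LocFree.coeff (i : I) (φ : P i →ₗ[Rᵐᵒᵖ] R) (q : Q i) : LocFree α :=
  FreeAlgebra.ι ℤ (Sum.inr ⟨i, φ, q⟩)

/-- The defining relations of the universal localization: those of `R`, and those that make the
coefficients into inverses of the `α i`. -/
inductive LocRel : LocFree α → LocFree α → Prop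
  | one : LocRel (.of α 1) 1
  | mul (r s : R) : LocRel (.of α (r * s)) (.of α r * .of α s)
  | add (r s : R) : LocRel (.of α (r + s)) (.of α r + .of α s)
  | add_left (i φ φ' q) : LocRel (.coeff α i (φ + φ') q) (.coeff α i φ q + .coeff α i φ' q)
  | smul_left (i) (r : R) (φ q) : LocRel (.coeff α i (r • φ) q) (.of α r * .coeff α i φ q)
  | add_right (i φ q q') : LocRel (.coeff α i φ (q + q')) (.coeff α i φ q + .coeff α i φ q')
  | smul_right (i) (r : R) (φ q) : LocRel (.coeff α i φ (op r • q)) (.coeff α i φ q * .of α r)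
  | apply_right (i φ p) : LocRel (.coeff α i φ (α i p)) (.of α (φ p))
  | comp_left (i) (ψ : Q i →ₗ[Rᵐᵒᵖ] R) (q) : LocRel (.coeff α i (ψ.comp (α i)) q) (.of α (ψ q))

/-- The universal localization at the `α i`, by generators and relations. -/
abbrev Loc : Type u := RingQuot (LocRel α)

/-- The canonical ring homomorphism `R → Loc α`. -/
def Loc.of : R →+* Loc α :=
  RingHom.mk' ⟨⟨fun r => RingQuot.mkRingHom (LocRel α) (.of α r),
    (RingQuot.mkRingHom_rel .one).trans (map_one _)⟩,
    fun r s => (RingQuot.mkRingHom_rel (.mul r s)).trans (map_mul _ _ _)⟩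
    fun r s => (RingQuot.mkRingHom_rel (.add r s)).trans (map_add _ _ _)

/-- The universal inverse of `α i`. -/
def Loc.dualInverse (i : I) : DualInverse (Loc.of α) (α i) where
  coeff φ q := RingQuot.mkRingHom (LocRel α) (.coeff α i φ q)
  add_left _ _ _ := (RingQuot.mkRingHom_rel (.add_left ..)).trans (map_add _ _ _)
  smul_left _ _ _ := (RingQuot.mkRingHom_rel (.smul_left ..)).trans (map_mul _ _ _)
  add_right _ _ _ := (RingQuot.mkRingHom_rel (.add_right ..)).trans (map_add _ _ _)
  smul_right _ _ _ := (RingQuot.mkRingHom_rel (.smul_right ..)).trans (map_mul _ _ _)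
  apply_right _ _ := RingQuot.mkRingHom_rel (.apply_right ..)
  comp_left _ _ := RingQuot.mkRingHom_rel (.comp_left ..)

variable {α} {T : Type u} [Ring T]

/-- The ring homomorphism out of `Loc α` given by inverses of the `α i`. -/
def Loc.lift (g : R →+* T) (b : ∀ i, DualInverse g (α i)) : Loc α →+* T :=
  RingQuot.lift ⟨(FreeAlgebra.lift ℤ (Sum.elim g fun x => (b x.1).coeff x.2.1 x.2.2)).toRingHom, by
    rintro _ _ (_ | _ | _ | _ | _ | _ | _ | _ | _) <;>
      simp [LocFree.of, LocFree.coeff, DualInverse.add_left, DualInverse.smul_left,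
        DualInverse.add_right, DualInverse.smul_right, DualInverse.apply_right,
        DualInverse.comp_left]⟩

lemma Loc.lift_comp_of (g : R →+* T) (b : ∀ i, DualInverse g (α i)) :
    (Loc.lift g b).comp (Loc.of α) = g := by
  ext r
  refine (RingQuot.lift_mkRingHom_apply _ _ _).trans ?_
  simp [LocFree.of]

lemma Loc.ringHom_ext {h h' : Loc α →+* T} (H : h.comp (Loc.of α) = h'.comp (Loc.of α))
    (H' : ∀ i φ q, h ((Loc.dualInverse α i).coeff φ q) = h' ((Loc.dualInverse α i).coeff φ q)) :
    h = h' := by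
  refine RingQuot.ringQuot_ext _ _ ?_
  have : (h.comp (RingQuot.mkRingHom (LocRel α))).toIntAlgHom =
      (h'.comp (RingQuot.mkRingHom (LocRel α))).toIntAlgHom := by
    refine FreeAlgebra.hom_ext (funext ?_)
    rintro (r | ⟨i, φ, q⟩)
    · exact RingHom.congr_fun H r
    · exact H' i φ q
  ext x
  exact DFunLike.congr_fun this x

lemma Loc.existsUnique_lift
    [∀ i, Module.Finite Rᵐᵒᵖ (P i)] [∀ i, Module.Projective Rᵐᵒᵖ (P i)]
    [∀ i, Module.Finite Rᵐᵒᵖ (Q i)] [∀ i, Module.Projective Rᵐᵒᵖ (Q i)] (g : R →+* T)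
    (hg : ∀ i, Function.Bijective (tensorMap g (α i))) :
    ∃! h : Loc α →+* T, h.comp (Loc.of α) = g := by
  have hg' i := (bijective_tensorMap_iff g (α i)).1 (hg i)
  have b i : DualInverse g (α i) := (DualInverse.nonempty_of_bijective (hg' i)).some
  -- Any factorization carries the universal inverses to inverses over `g`, and those are unique.
  have aux (h : Loc α →+* T) (e : h.comp (Loc.of α) = g) (i φ q) :
      h ((Loc.dualInverse α i).coeff φ q) = (b i).coeff φ q := by
    subst e
    exact DualInverse.coeff_eq_of_bijective (hg' i) ((Loc.dualInverse α i).map h) (b i) φ q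
  have hl := Loc.lift_comp_of g b
  exact ⟨Loc.lift g b, hl, fun h hh => Loc.ringHom_ext (hh.trans hl.symm) fun i φ q =>
    (aux h hh i φ q).trans (aux _ hl i φ q).symm⟩

end Construction

/-! ### Linearity along ring epimorphisms -/

section Epi

variable {R S : Type u} [Ring R] [Ring S]

/-- The additive endomorphism `(m, n) ↦ (m, n + φ m)` of `M × N`. -/
def shear {M N : Type u} [AddCommGroup M] [AddCommGroup N] (φ : M →+ N) : AddMonoid.End (M × N) :=
  (AddMonoidHom.fst M N).prod (AddMonoidHom.snd M N + φ.comp (AddMonoidHom.fst M N))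

@[simp]
lemma shear_apply {M N : Type u} [AddCommGroup M] [AddCommGroup N] (φ : M →+ N) (x : M × N) :
    shear φ x = (x.1, x.2 + φ x.1) := rfl

lemma shear_mul_shear_neg {M N : Type u} [AddCommGroup M] [AddCommGroup N] (φ : M →+ N) :
    shear φ * shear (-φ) = 1 :=
  AddMonoidHom.ext fun x => Prod.ext rfl (neg_add_cancel_right x.2 (φ x.1))

lemma shear_neg_mul_shear {M N : Type u} [AddCommGroup M] [AddCommGroup N] (φ : M →+ N) :
    shear (-φ) * shear φ = 1 := by
  simpa using shear_mul_shear_neg (-φ)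

/-- An additive map of right `S`-modules which is linear over `R` is linear over `S`, if `R → S`
is an epimorphism of rings. -/
lemma map_op_smul_of_epi (f : R →+* S)
    (hf : ∀ (T : Type u) [Ring T] (h h' : S →+* T), h.comp f = h'.comp f → h = h')
    {M N : Type u} [AddCommGroup M] [Module Sᵐᵒᵖ M] [AddCommGroup N] [Module Sᵐᵒᵖ N]
    (φ : M →+ N) (hφ : ∀ r m, φ (op (f r) • m) = op (f r) • φ m) (s : S) (m : M) :
    φ (op s • m) = op s • φ m := by
  let act := rightAction S (M × N)
  -- The action on `M × N` conjugated by the shear. It agrees with `act` on `R` because `φ` is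
  -- `R`-linear, hence on all of `S`; comparing both at `(m, 0)` gives the claim.
  let conj : S →+* (AddMonoid.End (M × N))ᵐᵒᵖ :=
    { toFun := fun s => op (shear φ * (act s).unop * shear (-φ))
      map_one' := by simp [shear_mul_shear_neg]
      map_mul' := fun s t => unop_injective <| by
        simp only [map_mul, unop_mul, unop_op]
        calc _ = shear φ * (act t).unop * 1 * (act s).unop * shear (-φ) := by simp [mul_assoc]
          _ = _ := by rw [← shear_neg_mul_shear φ]; simp only [mul_assoc]
      map_zero' := by simp
      map_add' := fun s t => by simp [mul_add, add_mul] }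
  have conj_apply (s : S) (x : M × N) :
      (conj s).unop x = (op s • x.1, op s • (x.2 - φ x.1) + φ (op s • x.1)) := by
    rw [sub_eq_add_neg]; rfl
  have h : act = conj := hf _ _ _ (RingHom.ext fun r => unop_injective
    (AddMonoidHom.ext fun x => by
      refine Eq.trans ?_ (conj_apply _ _).symm
      rw [hφ, smul_sub, sub_add_cancel]
      rfl))
  have key := conj_apply s (m, 0)
  rw [← h] at key
  have key' : (0 : N) = op s • (0 - φ m) + φ (op s • m) := by
    simpa using (smul_zero (op s)).symm.trans (congrArg Prod.snd key)
  rw [zero_sub, smul_neg, eq_comm, neg_add_eq_zero] at key'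
  exact key'.symm

end Epi

/-- For a short exact sequence `0 → X₁ → X₂ → X₃ → 0` with `X₁` and `X₂` projective, all `Ext`
from `X₃` to `M` vanish if and only if every morphism `X₁ ⟶ M` extends uniquely to `X₂`. -/
lemma ext_eq_zero_iff_bijective {C : Type*} [Category C] [Abelian C] [HasExt C]
    {S : ShortComplex C} (hS : S.ShortExact) [Projective S.X₁] [Projective S.X₂] (M : C) :
    ((∀ g : S.X₃ ⟶ M, g = 0) ∧ ∀ i : ℕ, 0 < i → ∀ e : Abelian.Ext S.X₃ M i, e = 0) ↔
      Function.Bijective fun h : S.X₂ ⟶ M => S.f ≫ h := by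
  have := hS.epi_g
  constructor
  · rintro ⟨h₀, h₁⟩
    refine ⟨fun h h' H => ?_, fun h => ?_⟩
    · have H' : S.f ≫ (h - h') = 0 := by
        rw [Preadditive.comp_sub, sub_eq_zero]
        exact H
      rw [← sub_eq_zero, ← hS.exact.g_desc _ H', h₀ (hS.exact.desc _ H'), Limits.comp_zero]
    · obtain ⟨x, hx⟩ := Abelian.Ext.contravariant_sequence_exact₁ hS _ (Abelian.Ext.mk₀ h)
        (add_zero 1) (h₁ 1 one_pos _)
      obtain ⟨k, rfl⟩ := (Abelian.Ext.mk₀_bijective _ _).2 x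
      rw [Abelian.Ext.mk₀_comp_mk₀] at hx
      exact ⟨k, (Abelian.Ext.mk₀_bijective _ _).1 hx⟩
  · intro H
    refine ⟨fun g => ?_, fun i hi e => ?_⟩
    · rw [← cancel_epi S.g, Limits.comp_zero]
      exact H.1 (by simp)
    · obtain ⟨i, rfl⟩ := Nat.exists_eq_add_one.2 hi
      -- Dimension shift: `e` comes from `Ext^i(X₁, M)`. For `i = 0` this is a morphism that extends
      -- to `X₂`, so the connecting map kills it; for `i > 0` the group vanishes.
      obtain ⟨x, rfl⟩ := Abelian.Ext.contravariant_sequence_exact₃ hS _ e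
        (Abelian.Ext.eq_zero_of_projective _) (add_comm 1 i)
      obtain _ | i := i
      · obtain ⟨k, rfl⟩ := (Abelian.Ext.mk₀_bijective _ _).2 x
        obtain ⟨k, rfl⟩ := H.2 k
        simp only
        rw [← Abelian.Ext.mk₀_comp_mk₀, ← Abelian.Ext.comp_assoc _ _ _ (add_zero 1) _ (by simp),
          hS.extClass_comp, Abelian.Ext.zero_comp]
      · rw [Abelian.Ext.eq_zero_of_projective x, Abelian.Ext.comp_zero]

/-! ### Perpendicular categories as essential images -/

section

variable {R : Type u} [Ring R]

namespace ProjRes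

variable {U V : ModuleCat.{u} Rᵐᵒᵖ}

instance (r : ProjRes U) : Module.Finite Rᵐᵒᵖ r.P := r.finite_P
instance (r : ProjRes U) : Module.Projective Rᵐᵒᵖ r.P := r.projective_P
instance (r : ProjRes U) : Module.Finite Rᵐᵒᵖ r.Q := r.finite_Q
instance (r : ProjRes U) : Module.Projective Rᵐᵒᵖ r.Q := r.projective_Q

lemma ext_eq_zero_iff (r : ProjRes U) (M : ModuleCat.{u} Rᵐᵒᵖ) :
    ((∀ g : U ⟶ M, g = 0) ∧ ∀ i : ℕ, 0 < i → ∀ e : Abelian.Ext U M i, e = 0) ↔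
      Function.Bijective fun h : r.Q →ₗ[Rᵐᵒᵖ] M => h.comp r.α.hom := by
  let S : ShortComplex (ModuleCat.{u} Rᵐᵒᵖ) := ShortComplex.mk r.α r.π
    (ModuleCat.hom_ext r.exact.linearMap_comp_eq_zero)
  have hS : S.ShortExact :=
    { exact := (ShortComplex.ShortExact.moduleCat_exact_iff_function_exact _).2 r.exact
      mono_f := (ModuleCat.mono_iff_injective _).2 r.injective
      epi_g := (ModuleCat.epi_iff_surjective _).2 r.surjective }
  have : Projective S.X₁ := (IsProjective.iff_projective _).1 r.projective_P
  have : Projective S.X₂ := (IsProjective.iff_projective _).1 r.projective_Q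
  rw [ext_eq_zero_iff_bijective hS M, ← Function.Bijective.of_comp_iff' ModuleCat.homEquiv.bijective,
    ← Function.Bijective.of_comp_iff _ (ModuleCat.homEquiv (M := r.Q) (N := M)).bijective]
  rfl

/-- A projective resolution of `U` is one of every module isomorphic to `U`. -/
def ofIso (r : ProjRes U) (e : U ≅ V) : ProjRes V where
  P := r.P
  Q := r.Q
  α := r.α
  π := r.π ≫ e.hom
  finite_P := r.finite_P
  projective_P := r.projective_P
  finite_Q := r.finite_Q
  projective_Q := r.projective_Q
  injective := r.injective
  exact x := (map_eq_zero_iff _ e.toLinearEquiv.injective).trans (r.exact x)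
  surjective := e.toLinearEquiv.surjective.comp r.surjective

/-- Both sides say that `M` is perpendicular to the same module up to isomorphism, so the choice of
resolution is irrelevant. -/
lemma bijective_iff_of_iso (r : ProjRes U) (r' : ProjRes V) (e : U ≅ V)
    (M : ModuleCat.{u} Rᵐᵒᵖ) :
    (Function.Bijective fun h : r.Q →ₗ[Rᵐᵒᵖ] M => h.comp r.α.hom) ↔
      Function.Bijective fun h : r'.Q →ₗ[Rᵐᵒᵖ] M => h.comp r'.α.hom :=
  ((r.ofIso e).ext_eq_zero_iff M).symm.trans (r'.ext_eq_zero_iff M)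

lemma nonempty (U : ModuleCat.{u} Rᵐᵒᵖ) (hU : Module.FinitePresentation Rᵐᵒᵖ U)
    [HasProjectiveDimensionLE U 1] : Nonempty (ProjRes U) := by
  obtain ⟨n, π, hπ⟩ := Module.Finite.exists_fin' Rᵐᵒᵖ U
  let S : ShortComplex (ModuleCat.{u} Rᵐᵒᵖ) := ShortComplex.mk
    (ModuleCat.ofHom (LinearMap.ker π).subtype) (ModuleCat.ofHom π)
    (ModuleCat.hom_ext (LinearMap.exact_subtype_ker_map π).linearMap_comp_eq_zero)
  have hS : S.ShortExact :=
    { exact := (ShortComplex.ShortExact.moduleCat_exact_iff_function_exact _).2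
        (LinearMap.exact_subtype_ker_map π)
      mono_f := (ModuleCat.mono_iff_injective _).2 (LinearMap.ker π).injective_subtype
      epi_g := (ModuleCat.epi_iff_surjective _).2 hπ }
  have h₂ : Projective S.X₂ := (IsProjective.iff_projective _).1
    (inferInstanceAs (Module.Projective Rᵐᵒᵖ (Fin n → Rᵐᵒᵖ)))
  -- Projective dimension at most one makes the first syzygy projective.
  have h₁ : Projective S.X₁ := projective_iff_hasProjectiveDimensionLT_one.2
    ((hS.hasProjectiveDimensionLT_X₃_iff 0 h₂).1 ‹_›)
  exact ⟨{
    P := S.X₁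
    Q := S.X₂
    α := S.f
    π := S.g
    finite_P := Module.Finite.iff_fg.2 (Module.FinitePresentation.fg_ker π hπ)
    projective_P := (IsProjective.iff_projective _).2 h₁
    finite_Q := inferInstanceAs (Module.Finite Rᵐᵒᵖ (Fin n → Rᵐᵒᵖ))
    projective_Q := (IsProjective.iff_projective _).2 h₂
    injective := (LinearMap.ker π).injective_subtype
    exact := LinearMap.exact_subtype_ker_map π
    surjective := hπ }⟩

end ProjRes

variable {𝒰 : Set (ModuleCat.{u} Rᵐᵒᵖ)} (res : ∀ U : 𝒰, ProjRes U.1)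

lemma perp_iff (M : ModuleCat.{u} Rᵐᵒᵖ) :
    perp 𝒰 M ↔ ∀ U : 𝒰,
      Function.Bijective fun h : (res U).Q →ₗ[Rᵐᵒᵖ] M => h.comp (res U).α.hom := by
  simp only [← ProjRes.ext_eq_zero_iff, perp, ← forall_and, Subtype.forall]

instance : (perp 𝒰).IsStableUnderRetracts where
  of_retract {X Y} h hY := by
    refine ⟨fun U hU g => ?_, fun U hU i hi e => ?_⟩
    · rw [← Category.comp_id g, ← h.retract, ← Category.assoc, hY.1 U hU (g ≫ h.i),
        Limits.zero_comp]
    · rw [← Abelian.Ext.comp_mk₀_id e, ← h.retract, ← Abelian.Ext.mk₀_comp_mk₀,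
        ← Abelian.Ext.comp_assoc _ _ _ (add_zero i) _ (by simp), hY.2 U hU i hi (e.comp _ _),
        Abelian.Ext.zero_comp]

variable {S : Type u} [Ring S] (f : R →+* S)

lemma isInverting_chosenMaps_iff : IsInverting (chosenMaps res) f ↔
    ∀ U : 𝒰, Function.Bijective (tensorMap f (res U).α.hom) :=
  Set.forall_mem_range

/-- Semilinear maps along `R → S` are linear maps into the restriction of scalars. -/
noncomputable def semilinearEquiv (Q : Type u) [AddCommGroup Q] [Module Rᵐᵒᵖ Q] (N : ModuleCat.{u} Sᵐᵒᵖ) :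
    (Q →ₛₗ[RingHom.op f] N) ≃
      (Q →ₗ[Rᵐᵒᵖ] (ModuleCat.restrictScalars.{u} (RingHom.op f)).obj N) where
  toFun h := { toFun := h, map_add' := h.map_add, map_smul' := h.map_smulₛₗ }
  invFun h := { toFun := h, map_add' := h.map_add, map_smul' := h.map_smul }

lemma bijective_comp_semilinear_iff {P Q : Type u} [AddCommGroup P] [Module Rᵐᵒᵖ P]
    [AddCommGroup Q] [Module Rᵐᵒᵖ Q] (α : P →ₗ[Rᵐᵒᵖ] Q) (N : ModuleCat.{u} Sᵐᵒᵖ) :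
    (Function.Bijective fun h : Q →ₛₗ[RingHom.op f] N => h.comp α) ↔
      Function.Bijective fun h :
        Q →ₗ[Rᵐᵒᵖ] (ModuleCat.restrictScalars.{u} (RingHom.op f)).obj N => h.comp α := by
  rw [← Function.Bijective.of_comp_iff' (semilinearEquiv f P N).bijective,
    ← Function.Bijective.of_comp_iff _ (semilinearEquiv f Q N).bijective]
  rfl

lemma perp_restrictScalars_of_isInverting (hf : IsInverting (chosenMaps res) f)
    (N : ModuleCat.{u} Sᵐᵒᵖ) : perp 𝒰 ((ModuleCat.restrictScalars.{u} (RingHom.op f)).obj N) :=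
  (perp_iff res _).2 fun U => (bijective_comp_semilinear_iff f _ N).1
    (bijective_comp_of_bijective_tensorMap f _ ((isInverting_chosenMaps_iff res f).1 hf U))

lemma isInverting_comp {T : Type u} [Ring T] (h : S →+* T)
    (hf : IsInverting (chosenMaps res) f) : IsInverting (chosenMaps res) (h.comp f) :=
  (isInverting_chosenMaps_iff res _).2 fun U =>
    bijective_tensorMap_comp f h ((isInverting_chosenMaps_iff res f).1 hf U)

lemma isInverting_rightAction {M : ModuleCat.{u} Rᵐᵒᵖ} (hM : perp 𝒰 M) :
    IsInverting (chosenMaps res) (rightAction R M) :=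
  (isInverting_chosenMaps_iff res _).2 fun U => (bijective_tensorMap_iff _ _).2
    (bijective_comp_rightAction M _ ((perp_iff res M).1 hM U))

/-- Finitely presented modules have only a small set of isomorphism classes. -/
lemma exists_small_representatives (hfp : ∀ U ∈ 𝒰, Module.FinitePresentation Rᵐᵒᵖ U) :
    ∃ (I : Type u) (V : I → 𝒰), ∀ U : 𝒰, ∃ i, Nonempty ((V i).1 ≅ U.1) := by
  let I := {K : Σ n : ℕ, Submodule Rᵐᵒᵖ (Fin n → Rᵐᵒᵖ) //
    ∃ U : 𝒰, Nonempty (U.1 ≃ₗ[Rᵐᵒᵖ] (Fin K.1 → Rᵐᵒᵖ) ⧸ K.2)}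
  refine ⟨I, fun i => i.2.choose, fun U => ?_⟩
  have := hfp U.1 U.2
  obtain ⟨n, K, e, -⟩ := Module.FinitePresentation.exists_fin Rᵐᵒᵖ U.1
  let i : I := ⟨⟨n, K⟩, U, ⟨e⟩⟩
  exact ⟨i, ⟨(i.2.choose_spec.some.trans e.symm).toModuleIso⟩⟩

/-- `𝒰` may be too large to index generators in universe `u`, so only representatives of isomorphism
classes are inverted. The other maps then become invertible too, by testing on `Loc α` itself. -/
lemma exists_isUniversalLocalization (hfp : ∀ U ∈ 𝒰, Module.FinitePresentation Rᵐᵒᵖ U) :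
    ∃ (S : Type u) (_ : Ring S) (f : R →+* S), IsUniversalLocalization (chosenMaps res) f := by
  obtain ⟨I, V, hV⟩ := exists_small_representatives hfp
  let α i := (res (V i)).α.hom
  refine ⟨Loc α, inferInstance, Loc.of α, ⟨(isInverting_chosenMaps_iff res _).2 fun U => ?_,
    fun T _ g hg => Loc.existsUnique_lift g fun i => (isInverting_chosenMaps_iff res g).1 hg _⟩⟩
  obtain ⟨i, ⟨e⟩⟩ := hV U
  have hi := (bijective_tensorMap_iff _ _).1 (Loc.dualInverse α i).bijective_tensorMap
  rw [bijective_tensorMap_iff]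
  exact (bijective_comp_semilinear_iff _ _ (ModuleCat.of _ (Loc α))).2
    (((res (V i)).bijective_iff_of_iso (res U) e _).1
      ((bijective_comp_semilinear_iff _ _ (ModuleCat.of _ (Loc α))).1 hi))

variable {f}

lemma perp_eq_essImage (hf : IsUniversalLocalization (chosenMaps res) f) :
    perp 𝒰 = (ModuleCat.restrictScalars.{u} (RingHom.op f)).essImage := by
  ext M
  constructor
  · intro hM
    obtain ⟨h, hh, -⟩ := hf.existsUnique_lift _ _ (isInverting_rightAction res hM)
    -- The factorization of the action of `R` through `S` is the sought right `S`-action on `M`.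
    let ρ : Sᵐᵒᵖ →+* AddMonoid.End M :=
      { toFun := fun s => (h s.unop).unop
        map_one' := by simp
        map_mul' := by simp
        map_zero' := by simp
        map_add' := by simp }
    let mS : Module Sᵐᵒᵖ M := Module.compHom M ρ
    let N : ModuleCat.{u} Sᵐᵒᵖ := ModuleCat.of Sᵐᵒᵖ M
    let e : (ModuleCat.restrictScalars.{u} (RingHom.op f)).obj N ≃ₗ[Rᵐᵒᵖ] M :=
      { toFun := fun m => m
        invFun := fun m => m
        map_add' := fun _ _ => rfl
        map_smul' := fun r m =>
          DFunLike.congr_fun (congrArg unop (RingHom.congr_fun hh r.unop)) m }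
    exact ⟨N, ⟨e.toModuleIso⟩⟩
  · rintro ⟨N, ⟨e⟩⟩
    exact (perp 𝒰).prop_of_iso e (perp_restrictScalars_of_isInverting res f hf.inverting N)

/-- Uniqueness of factorizations makes `f` an epimorphism of rings, so `R`-linear maps between
`S`-modules are `S`-linear. -/
lemma full_restrictScalars (hf : IsUniversalLocalization (chosenMaps res) f) :
    (ModuleCat.restrictScalars.{u} (RingHom.op f)).Full where
  map_surjective {M N} φ := by
    refine ⟨ModuleCat.ofHom
      { toFun := φ, map_add' := map_add φ.hom, map_smul' := fun s m => ?_ }, rfl⟩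
    refine map_op_smul_of_epi f (fun T _ h h' H => ?_) (M := M) (N := N) φ.hom.toAddMonoidHom
      (fun r m => φ.hom.map_smul (op r) m) s.unop m
    exact (hf.existsUnique_lift T (h'.comp f) (isInverting_comp res f h' hf.inverting)).unique H rfl

/-- Homomorphisms `P ⊗_R S → N` of right `S`-modules are semilinear maps `P → N`. -/
def tensorLiftEquiv (f : R →+* S) (P : Type u) [AddCommGroup P] [Module Rᵐᵒᵖ P]
    (N : Type u) [AddCommGroup N] [Module Sᵐᵒᵖ N] :
    (Tensor f P →ₗ[Sᵐᵒᵖ] N) ≃ (P →ₛₗ[RingHom.op f] N) where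
  toFun g := g.comp (toTensor f)
  invFun := tensorLift f
  left_inv g := linearMap_ext_tmul f fun p => by simp
  right_inv h := by ext; simp

lemma isRightAdjoint_restrictScalars (f : R →+* S) :
    (ModuleCat.restrictScalars.{u} (RingHom.op f)).IsRightAdjoint :=
  (Adjunction.adjunctionOfEquivLeft
    (F_obj := fun P : ModuleCat.{u} Rᵐᵒᵖ => ModuleCat.of Sᵐᵒᵖ (Tensor f P))
    (fun P N => ModuleCat.homEquiv.trans ((tensorLiftEquiv f P N).trans
      ((semilinearEquiv f P N).trans ModuleCat.homEquiv.symm)))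
    fun _ _ _ _ _ => rfl).isRightAdjoint

lemma isBireflective_perp (hf : IsUniversalLocalization (chosenMaps res) f) :
    IsBireflective (perp 𝒰) := by
  let F := ModuleCat.restrictScalars.{u} (RingHom.op f)
  have : F.Full := full_restrictScalars res hf
  have : F.IsRightAdjoint := isRightAdjoint_restrictScalars f
  have : F.IsLeftAdjoint := (ModuleCat.restrictCoextendScalarsAdj.{u} (RingHom.op f)).isLeftAdjoint
  -- `F` is fully faithful, so the inclusion of its essential image is an equivalence followed by
  -- `F` and inherits both adjoints.
  have hι : F.toEssImage.inv ⋙ F ≅ F.essImage.ι :=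
    Functor.isoWhiskerLeft _ F.toEssImageCompι.symm ≪≫ (Functor.associator _ _ _).symm ≪≫
      Functor.isoWhiskerRight F.toEssImage.asEquivalence.counitIso _ ≪≫ Functor.leftUnitor _
  have hr : F.essImage.ι.IsRightAdjoint := Functor.isRightAdjoint_of_iso hι
  have hl : F.essImage.ι.IsLeftAdjoint := Functor.isLeftAdjoint_of_iso hι
  refine ⟨inferInstance, inferInstance, ?_, ?_⟩ <;> rw [perp_eq_essImage res hf]
  · exact ⟨⟨_, Adjunction.ofIsRightAdjoint _⟩⟩
  · exact ⟨⟨_, Adjunction.ofIsLeftAdjoint _⟩⟩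

end

end UnivLoc

theorem proposition1p6 {R : Type u} [Ring R] (𝒰 : Set (ModuleCat.{u} Rᵐᵒᵖ))
    (hfp : ∀ U ∈ 𝒰, Module.FinitePresentation Rᵐᵒᵖ U)
    (hpd : ∀ U ∈ 𝒰, HasProjectiveDimensionLE U 1) :
    UnivLoc.IsBireflective (UnivLoc.perp 𝒰) ∧
    (∀ U ∈ 𝒰, Nonempty (UnivLoc.ProjRes U)) ∧
    ∀ res : (∀ U : 𝒰, UnivLoc.ProjRes U.1),
      (∃ (S : Type u) (_ : Ring S) (f : R →+* S),
        UnivLoc.IsUniversalLocalization (UnivLoc.chosenMaps res) f) ∧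
      ∀ (S : Type u) [Ring S] (f : R →+* S),
        UnivLoc.IsUniversalLocalization (UnivLoc.chosenMaps res) f →
          UnivLoc.perp 𝒰 =
            (ModuleCat.restrictScalars.{u} (RingHom.op f)).essImage := by
  have hres : ∀ U ∈ 𝒰, Nonempty (UnivLoc.ProjRes U) := fun U hU =>
    have := hpd U hU
    UnivLoc.ProjRes.nonempty U (hfp U hU)
  refine ⟨?_, hres, fun res => ⟨UnivLoc.exists_isUniversalLocalization res hfp,
    fun S _ f hf => UnivLoc.perp_eq_essImage res hf⟩⟩
  let res (U : 𝒰) : UnivLoc.ProjRes U.1 := (hres U.1 U.2).some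
  obtain ⟨S, _, f, hf⟩ := UnivLoc.exists_isUniversalLocalization res hfp
  exact UnivLoc.isBireflective_perp res hf
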